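/- Let $E$ be a finite nonempty set of items, $O$ a set of states, and $p$ a discrete probability distribution on realizations $\phi: E\to O$; let $\Phi\sim p$. Let $f: 2^E\times O^E\to\mathbb{R}_{\ge 0}$ with $\mathbb{E}[f(A,\Phi)]<\infty$ for every $A\subseteq E$, and write $f(e)=\mathbb{E}[f(\{e\},\Phi)]$. A partial realization $\psi$ is a map from a subset $\mathrm{dom}(\psi)\subseteq E$ to $O$; write $\psi\prec\phi$ if $\phi$ extends $\psi$. For $\Pr[\psi\prec\Phi]>0$ put $$\Delta(e\mid\psi)=\mathbb{E}\left[f(\mathrm{dom}(\psi)\cup\{e\},\Phi)-f(\mathrm{dom}(\psi),\Phi)\mid\psi\prec\Phi\right].$$ Assume that $f$ is adaptive submodular with respect to $p$: $\Delta(e\mid\psi)\ge\Delta(e\mid\psi')$ whenever $\psi'$ extends $\psi$, $\Pr[\psi'\prec\Phi]>0$ and $e\notin\mathrm{dom}(\psi')$. (Pointwise submodularity is not assumed.) A (possibly randomized) policy $\pi$ selects items one at a time without repetition; each time an item is selected its state is revealed, and the choice of the next item, or the decision to stop, depends only on the observations so far and on internal randomness independent of $\Phi$. Let $E(\pi,\phi)$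 be the random set selected by $\pi$ under the realization $\phi$, and let $f_{avg}(\pi)=\mathbb{E}[f(E(\pi,\Phi),\Phi)]$. The concatenation $\pi@\pi'$ runs $\pi$ and then runs $\pi'$ afresh, ignoring the observations of $\pi$ and using independent randomness; it selects $E(\pi,\phi)\cup E(\pi',\phi)$. Given costs $c_e>0$ and a budget $b$, a policy is feasible if, for every $\phi$ with $p(\phi)>0$, almost surely $\sum_{e\in E(\pi,\phi)}c_e\le b$. Let $\pi^{opt}$ be a feasible policy that maximizes $f_{avg}$ among all feasible policies, and let $e^*\in\arg\max_{e\in E}f(e)$. Let $\sigma\in(0,1]$ and let $\pi$ be the following density-greedy policy. It draws a random set $S\subseteq E$ that contains each item independently with probability $\sigma$. While its current observation is $\psi$, it selects an item maximizing $\Delta(e\mid\psi)/c_e$ over $$F=\Big\{e\in S\setminus\mathrm{dom}(\psi) : c_e\le b-\sum_{i\in\mathrm{dom}(\psi)}c_i,\ \Delta(e\mid\psi)>0\Big\},$$ where ties are broken by an arbitrary priority order on $E$ that may depend on $\psi$ but not on $S$; it stops when $F=\emptyset$. Then $$\left(2+\frac1\sigma\right)f_{avg}(\pi)+f(e^*)\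 \ge\ f_{avg}(\pi^{opt}@\pi).$$ -/

import Mathlib

open scoped NNReal ENNReal

universe u v

namespace AdaptiveSubmodular

noncomputable section

/-- A partial realization: `ψ e = some o` means that `e` lies in the domain of `ψ` and has
state `o`; `ψ e = none` means that `e` is not in the domain. -/
abbrev PartialRealization (E : Type u) (O : Type v) := E → Option O

variable {E : Type u} {O : Type v} [Fintype E] [DecidableEq E]

/-- The domain of a partial realization. -/
def dom (ψ : PartialRealization E O) : Finset E :=
  Finset.univ.filter fun e => (ψ e).isSome

/-- `ψ` is consistent with the realization `φ`. -/
def Consistent (ψ : PartialRealization E O) (φ : E → O) : Prop :=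
  ∀ e o, ψ e = some o → φ e = o

/-- `ψ` is a subrealization of `ψ'`. -/
def SubRealization (ψ ψ' : PartialRealization E O) : Prop :=
  ∀ e o, ψ e = some o → ψ' e = some o

/-- The probability that the random realization is consistent with `ψ`. -/
def prob (p : PMF (E → O)) (ψ : PartialRealization E O) : ℝ :=
  ∑' φ, Set.indicator {φ | Consistent ψ φ} (fun φ => (p φ).toReal) φ

/-- The conditional expected marginal utility `Δ(e ∣ ψ)`. It is only meaningful
when `ψ` has positive probability. -/
def marginal (f : Finset E → (E → O) → ℝ≥0) (p : PMF (E → O)) (e : E)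
    (ψ : PartialRealization E O) : ℝ :=
  (∑' φ, Set.indicator {φ | Consistent ψ φ}
    (fun φ => (p φ).toReal * ((f (dom ψ ∪ {e}) φ : ℝ) - f (dom ψ) φ)) φ) / prob p ψ

/-- Every fixed set of items has a finite expected utility (automatic when the set of
realizations is finite). -/
def FiniteExpectation (f : Finset E → (E → O) → ℝ≥0) (p : PMF (E → O)) : Prop :=
  ∀ A : Finset E, Summable fun φ => (p φ).toReal * (f A φ : ℝ)

/-- Adaptive submodularity of `f` with respect to the prior `p`. -/
def IsAdaptiveSubmodular (f : Finset E → (E → O) → ℝ≥0) (p : PMF (E → O)) : Prop :=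
  ∀ ψ ψ' : PartialRealization E O, SubRealization ψ ψ' → 0 < prob p ψ' →
    ∀ e, e ∉ dom ψ' → marginal f p e ψ' ≤ marginal f p e ψ

/-- The expected utility `f(e)` of the single item `e`. -/
def singletonValue (f : Finset E → (E → O) → ℝ≥0) (p : PMF (E → O)) (e : E) : ℝ :=
  ∑' φ, (p φ).toReal * (f {e} φ : ℝ)

/-- An adaptive, possibly randomized, policy. It may draw a random seed before it starts; then
it maps the current observation to a distribution over the next item, where `none` means that it
stops. It never selects an item again that it has already selected. -/
structure Policy (E : Type u) (O : Type v) where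
  Seed : Type u
  law : PMF Seed
  next : Seed → PartialRealization E O → PMF (Option E)
  fresh : ∀ s ψ e, some e ∈ (next s ψ).support → ψ e = none

/-- The law of the observation obtained from `ψ` by making at most `n` further selections
according to the rule `g` under the realization `φ`. -/
def runFrom (g : PartialRealization E O → PMF (Option E)) (φ : E → O) :
    ℕ → PartialRealization E O → PMF (PartialRealization E O)
  | 0, ψ => PMF.pure ψ
  | n + 1, ψ => (g ψ).bind fun o =>
      match o with
      | none => PMF.pure ψ
      | some e => runFrom g φ n (Function.update ψ e (some (φ e)))

/-- The law of the random set `E(π, φ)` of the items selected by `π` under `φ`. A policy makes at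
most `|E|` selections because it never repeats an item. -/
def Policy.out (π : Policy E O) (φ : E → O) : PMF (Finset E) :=
  π.law.bind fun s => (runFrom (π.next s) φ (Fintype.card E) fun _ => none).map dom

/-- The law of the set selected by the concatenation `π @ π'` under `φ`: first `π` is run, then
`π'` is run afresh, ignoring the observations of `π` and with independent internal randomness. -/
def concatOut (π π' : Policy E O) (φ : E → O) : PMF (Finset E) :=
  (π.out φ).bind fun A => (π'.out φ).map fun B => A ∪ B

/-- The expected utility when the selected set has law `K φ` under the realization `φ`. -/
def expectedUtility (f : Finset E → (E → O) → ℝ≥0) (p : PMF (E → O))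
    (K : (E → O) → PMF (Finset E)) : ℝ :=
  ∑' φ, (p φ).toReal * ∑ A : Finset E, (K φ A).toReal * (f A φ : ℝ)

/-- `f_avg(π)`. -/
def favg (f : Finset E → (E → O) → ℝ≥0) (p : PMF (E → O)) (π : Policy E O) : ℝ :=
  expectedUtility f p π.out

/-- `f_avg(π @ π')`. -/
def favgConcat (f : Finset E → (E → O) → ℝ≥0) (p : PMF (E → O)) (π π' : Policy E O) : ℝ :=
  expectedUtility f p (concatOut π π')

/-- The policies that are feasible for the knapsack constraint with costs `c` and budget `b`. -/
def Feasible (p : PMF (E → O)) (c : E → ℝ) (b : ℝ) (π : Policy E O) : Prop :=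
  ∀ φ, p φ ≠ 0 → ∀ A ∈ (π.out φ).support, ∑ e ∈ A, c e ≤ b

/-- `π` is a feasible policy of maximum expected utility. -/
def IsOptimal (f : Finset E → (E → O) → ℝ≥0) (p : PMF (E → O)) (c : E → ℝ) (b : ℝ)
    (π : Policy E O) : Prop :=
  Feasible p c b π ∧ ∀ π' : Policy E O, Feasible p c b π' → favg f p π' ≤ favg f p π

/-- The law of a random set that contains each item independently with probability `σ`. -/
def sampleLaw (E : Type u) [Fintype E] [DecidableEq E] (σ : ℝ) (h0 : 0 < σ) (h1 : σ ≤ 1) :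
    PMF (Finset E) :=
  PMF.ofFintype
    (fun S => ENNReal.ofReal σ ^ S.card * ENNReal.ofReal (1 - σ) ^ (Fintype.card E - S.card)) <| by
    rw [Fintype.sum_pow_mul_eq_add_pow, ← ENNReal.ofReal_add h0.le (by linarith)]
    simp

/-- The candidates of the density-greedy rule: the items of `S` that have not been selected yet,
fit into the remaining budget and have a positive conditional expected marginal utility. -/
def candidates (f : Finset E → (E → O) → ℝ≥0) (p : PMF (E → O)) (c : E → ℝ) (b : ℝ)
    (S : Finset E) (ψ : PartialRealization E O) : Set E :=
  {e | e ∈ S ∧ e ∉ dom ψ ∧ c e ≤ b - ∑ i ∈ dom ψ, c i ∧ 0 < marginal f p e ψ}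

/-- `e` is the candidate of largest benefit-to-cost ratio, ties being broken in favour of the
smallest rank. -/
def IsGreedyChoice (f : Finset E → (E → O) → ℝ≥0) (p : PMF (E → O)) (c : E → ℝ) (b : ℝ)
    (rank : PartialRealization E O → E ↪ ℕ) (S : Finset E) (ψ : PartialRealization E O)
    (e : E) : Prop :=
  e ∈ candidates f p c b S ψ ∧ ∀ e' ∈ candidates f p c b S ψ,
    marginal f p e' ψ / c e' < marginal f p e ψ / c e ∨
      (marginal f p e' ψ / c e' = marginal f p e ψ / c e ∧ rank ψ e ≤ rank ψ e')

open Classical in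
/-- The next item of the density-greedy rule on `S`; `none` if there is no candidate. -/
def greedyNext (f : Finset E → (E → O) → ℝ≥0) (p : PMF (E → O)) (c : E → ℝ) (b : ℝ)
    (rank : PartialRealization E O → E ↪ ℕ) (S : Finset E) (ψ : PartialRealization E O) :
    Option E :=
  if h : ∃ e, IsGreedyChoice f p c b rank S ψ e then some h.choose else none

/-- The policy that draws a random set `S`, containing each item independently with probability
`σ`, and then selects items of `S` in the density-greedy manner. -/
def sampledGreedy (f : Finset E → (E → O) → ℝ≥0) (p : PMF (E → O)) (c : E → ℝ) (b : ℝ)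
    (rank : PartialRealization E O → E ↪ ℕ) (σ : ℝ) (h0 : 0 < σ) (h1 : σ ≤ 1) : Policy E O where
  Seed := Finset E
  law := sampleLaw E σ h0 h1
  next S ψ := PMF.pure (greedyNext f p c b rank S ψ)
  fresh S ψ e he := by
    have h : greedyNext f p c b rank S ψ = some e := by
      simpa [PMF.support_pure, eq_comm] using he
    unfold greedyNext at h
    split_ifs at h with hex
    have h2 := hex.choose_spec.1.2.1
    rw [Option.some.inj h] at h2
    simpa [dom] using h2

end

end AdaptiveSubmodular

/-! Fix the sampled set `S`, and let `ψ` be the final observation of the greedy run on `S`. That the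
run ends with `ψ` is the same event as consistency of the realization with `ψ`. So on this event the
optimal policy is run on top of a known partial realization. By adaptive submodularity its expected
gain is at most the expected sum, over the set `A` it selects, of the positive parts of `Δ(e ∣ ψ)`
for unobserved `e` (`expectOn_runFrom_le`).

This sum is bounded realization by realization. For an item `e ∈ A` with `Δ(e ∣ ψ) > 0`, compare the
runs on `S` and on `S ∪ {e}`: they agree until the second selects `e` or `e` no longer fits
(`itemGain_or_totalGain_ge`). If `e` is selected, then `e ∉ S`, and `Δ(e ∣ ψ)` is at most the gain
of `e` in the run on `S ∪ {e}`. Otherwise the run on `S` has spent more than `b - c e` on items at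
least as dense as `e`, so `Δ(e ∣ ψ) (b - c e)` is at most `c e` times its total gain. Since `A` is
feasible, the items of this second kind together contribute at most the total gain of the run, plus
one item of largest cost, which is worth at most `f(e*)` (`sum_le_of_density_le`).

Now average over `S`. Membership of `e` is an independent coin, so the missed gains of the first
kind equal `1/σ - 1` times the expected greedy gain (`sum_sampleLaw_insert`). That gain is at most
`f_avg(π)` (`expectOn_totalGain_le`). In total the concatenation is worth at most `(1 + 1/σ)
f_avg(π) + f(e*)`, which implies the claim. -/

namespace AdaptiveSubmodular

noncomputable section

set_option linter.unusedSectionVars false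

variable {E : Type u} {O : Type v}

/-! ### Expectations restricted to an event -/

/-- `F` has a finite expectation under `p`. -/
def HasExpectation (p : PMF (E → O)) (F : (E → O) → ℝ) : Prop :=
  Summable fun φ => (p φ).toReal * F φ

/-- The expectation of `F` on the event `C`. -/
def expectOn (p : PMF (E → O)) (C : Set (E → O)) (F : (E → O) → ℝ) : ℝ :=
  ∑' φ, C.indicator (fun φ => (p φ).toReal * F φ) φ

section Expectation

variable {p : PMF (E → O)} {C : Set (E → O)} {F G : (E → O) → ℝ}

theorem HasExpectation.add (hF : HasExpectation p F) (hG : HasExpectation p G) :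
    HasExpectation p fun φ => F φ + G φ := by
  simpa only [HasExpectation, mul_add] using Summable.add hF hG

theorem HasExpectation.sub (hF : HasExpectation p F) (hG : HasExpectation p G) :
    HasExpectation p fun φ => F φ - G φ := by
  simpa only [HasExpectation, mul_sub] using Summable.sub hF hG

theorem HasExpectation.const_mul (a : ℝ) (hF : HasExpectation p F) :
    HasExpectation p fun φ => a * F φ := by
  simpa only [HasExpectation, mul_left_comm] using Summable.mul_left a hF

theorem HasExpectation.sum {ι : Type*} {s : Finset ι} {F : ι → (E → O) → ℝ}
    (hF : ∀ i ∈ s, HasExpectation p (F i)) : HasExpectation p fun φ => ∑ i ∈ s, F i φ := by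
  simpa only [HasExpectation, Finset.mul_sum] using summable_sum hF

theorem hasSum_toReal_pmf {α : Type*} (q : PMF α) : HasSum (fun a => (q a).toReal) 1 := by
  have h : Summable fun a => (q a).toReal := ENNReal.summable_toReal q.tsum_coe_ne_top
  have h1 : ∑' a, (q a).toReal = 1 := by
    rw [← ENNReal.tsum_toReal_eq fun a => q.apply_ne_top a, q.tsum_coe, ENNReal.toReal_one]
  exact h1 ▸ h.hasSum

theorem hasExpectation_const (a : ℝ) : HasExpectation p fun _ => a :=
  (hasSum_toReal_pmf p).summable.mul_right a

theorem HasExpectation.of_abs_le (hG : HasExpectation p G) (h : ∀ φ, |F φ| ≤ G φ) :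
    HasExpectation p F := by
  refine Summable.of_norm_bounded hG fun φ => ?_
  rw [Real.norm_eq_abs, abs_mul, abs_of_nonneg ENNReal.toReal_nonneg]
  exact mul_le_mul_of_nonneg_left (h φ) ENNReal.toReal_nonneg

theorem expectOn_mono (hF : HasExpectation p F) (hG : HasExpectation p G)
    (h : ∀ φ ∈ C, p φ ≠ 0 → F φ ≤ G φ) : expectOn p C F ≤ expectOn p C G := by
  refine Summable.tsum_le_tsum (fun φ => ?_) (hF.indicator C) (hG.indicator C)
  by_cases hφ : φ ∈ C
  · simp only [Set.indicator_of_mem hφ]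
    by_cases hp : p φ = 0
    · simp [hp]
    · exact mul_le_mul_of_nonneg_left (h φ hφ hp) ENNReal.toReal_nonneg
  · simp [hφ]

theorem expectOn_congr (h : ∀ φ ∈ C, p φ ≠ 0 → F φ = G φ) :
    expectOn p C F = expectOn p C G := by
  refine tsum_congr fun φ => ?_
  by_cases hφ : φ ∈ C
  · simp only [Set.indicator_of_mem hφ]
    by_cases hp : p φ = 0
    · simp [hp]
    · rw [h φ hφ hp]
  · simp [hφ]

theorem expectOn_add (hF : HasExpectation p F) (hG : HasExpectation p G) :
    expectOn p C (fun φ => F φ + G φ) = expectOn p C F + expectOn p C G := by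
  simp only [expectOn]
  rw [← Summable.tsum_add (hF.indicator C) (hG.indicator C)]
  refine tsum_congr fun φ => ?_
  by_cases hφ : φ ∈ C <;> simp [hφ, mul_add]

theorem expectOn_const_mul (a : ℝ) :
    expectOn p C (fun φ => a * F φ) = a * expectOn p C F := by
  simp only [expectOn]
  rw [← tsum_mul_left]
  refine tsum_congr fun φ => ?_
  by_cases hφ : φ ∈ C <;> simp [hφ, mul_left_comm]

theorem expectOn_sub (hF : HasExpectation p F) (hG : HasExpectation p G) :
    expectOn p C (fun φ => F φ - G φ) = expectOn p C F - expectOn p C G := by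
  simp only [expectOn]
  rw [← Summable.tsum_sub (hF.indicator C) (hG.indicator C)]
  refine tsum_congr fun φ => ?_
  by_cases hφ : φ ∈ C <;> simp [hφ, mul_sub]

theorem expectOn_sum {ι : Type*} {s : Finset ι} {F : ι → (E → O) → ℝ}
    (hF : ∀ i ∈ s, HasExpectation p (F i)) :
    expectOn p C (fun φ => ∑ i ∈ s, F i φ) = ∑ i ∈ s, expectOn p C (F i) := by
  simp only [expectOn]
  rw [← Summable.tsum_finsetSum fun i hi => (hF i hi).indicator C]
  refine tsum_congr fun φ => ?_
  by_cases hφ : φ ∈ C <;> simp [hφ, Finset.mul_sum]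

theorem expectOn_nonneg (h : ∀ φ ∈ C, 0 ≤ F φ) : 0 ≤ expectOn p C F :=
  tsum_nonneg fun φ => Set.indicator_nonneg
    (fun φ hφ => mul_nonneg ENNReal.toReal_nonneg (h φ hφ)) φ

theorem expectOn_univ : expectOn p Set.univ F = ∑' φ, (p φ).toReal * F φ := by
  simp [expectOn]

theorem expectOn_univ_const (a : ℝ) : expectOn p Set.univ (fun _ => a) = a := by
  rw [expectOn_univ, tsum_mul_right, (hasSum_toReal_pmf p).tsum_eq, one_mul]

/-- Expectations may be compared on the fibres of a map. -/
theorem expectOn_le_of_fiberwise {ι : Type*} (q : (E → O) → ι) (hF : HasExpectation p F)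
    (hG : HasExpectation p G)
    (h : ∀ i, expectOn p (C ∩ q ⁻¹' {i}) F ≤ expectOn p (C ∩ q ⁻¹' {i}) G) :
    expectOn p C F ≤ expectOn p C G := by
  -- There may be infinitely many fibres; summability of the whole series lets it be regrouped along
  -- `q`.
  have key : ∀ {H : (E → O) → ℝ}, HasExpectation p H →
      HasSum (fun i => expectOn p (C ∩ q ⁻¹' {i}) H) (expectOn p C H) := by
    intro H hH
    have h1 := (Summable.hasSum (hH.indicator C)).tsum_fiberwise q
    have h2 : (fun i => expectOn p (C ∩ q ⁻¹' {i}) H) = fun i =>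
        ∑' φ : q ⁻¹' {i}, C.indicator (fun φ => (p φ).toReal * H φ) φ := by
      funext i
      rw [tsum_subtype (q ⁻¹' {i}) (C.indicator fun φ => (p φ).toReal * H φ)]
      refine tsum_congr fun φ => ?_
      rw [Set.indicator_indicator, Set.inter_comm]
    rw [h2]
    exact h1
  exact hasSum_le h (key hF) (key hG)

end Expectation

variable [Fintype E]

/-! ### Expectations of set functions -/

/-- The expectation of `H` under a law on sets of items. -/
def setExpect (q : PMF (Finset E)) (H : Finset E → ℝ) : ℝ :=
  ∑ A, (q A).toReal * H A

theorem setExpect_pure (A : Finset E) (H : Finset E → ℝ) :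
    setExpect (PMF.pure A) H = H A := by
  classical
  simp [setExpect, PMF.pure_apply, apply_ite ENNReal.toReal]

theorem setExpect_bind {α : Type*} (μ : PMF α) (k : α → PMF (Finset E)) (H : Finset E → ℝ) :
    setExpect (μ.bind k) H = ∑' a, (μ a).toReal * setExpect (k a) H := by
  have hs : ∀ A, Summable fun a => (μ a).toReal * ((k a A).toReal * H A) := by
    intro A
    refine Summable.of_norm_bounded ((hasSum_toReal_pmf μ).summable.mul_right |H A|) fun a => ?_
    rw [Real.norm_eq_abs, abs_mul, abs_mul, abs_of_nonneg ENNReal.toReal_nonneg,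
      abs_of_nonneg ENNReal.toReal_nonneg]
    refine mul_le_mul_of_nonneg_left ?_ ENNReal.toReal_nonneg
    refine mul_le_of_le_one_left (abs_nonneg _) ?_
    exact ENNReal.toReal_le_of_le_ofReal zero_le_one (by simpa using (k a).coe_le_one A)
  simp only [setExpect, Finset.mul_sum]
  rw [Summable.tsum_finsetSum fun A _ => hs A]
  refine Finset.sum_congr rfl fun A _ => ?_
  rw [PMF.bind_apply, ENNReal.tsum_toReal_eq
    fun a => ENNReal.mul_ne_top (μ.apply_ne_top a) ((k a).apply_ne_top A), ← tsum_mul_right]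
  simp only [ENNReal.toReal_mul, mul_assoc]

theorem setExpect_map (q : PMF (Finset E)) (F : Finset E → Finset E) (H : Finset E → ℝ) :
    setExpect (q.map F) H = setExpect q fun A => H (F A) := by
  rw [← PMF.bind_pure_comp, setExpect_bind, tsum_fintype]
  simp only [Function.comp_apply, setExpect_pure]
  rfl

theorem setExpect_mono (q : PMF (Finset E)) {H K : Finset E → ℝ}
    (h : ∀ A ∈ q.support, H A ≤ K A) : setExpect q H ≤ setExpect q K := by
  refine Finset.sum_le_sum fun A _ => ?_
  by_cases hA : q A = 0
  · simp [hA]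
  · exact mul_le_mul_of_nonneg_left (h A ((q.mem_support_iff A).mpr hA)) ENNReal.toReal_nonneg

theorem setExpect_const (q : PMF (Finset E)) (a : ℝ) : setExpect q (fun _ => a) = a := by
  have h := (hasSum_toReal_pmf q).tsum_eq
  rw [tsum_fintype] at h
  rw [setExpect, ← Finset.sum_mul, h, one_mul]

theorem setExpect_sub_const (q : PMF (Finset E)) (H : Finset E → ℝ) (a : ℝ) :
    setExpect q (fun A => H A - a) = setExpect q H - a := by
  conv_rhs => rw [← setExpect_const q a]
  simp [setExpect, mul_sub]

theorem abs_setExpect_le (q : PMF (Finset E)) {H : Finset E → ℝ} {a : ℝ} (h : ∀ A, |H A| ≤ a) :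
    |setExpect q H| ≤ a := by
  refine abs_le.mpr ⟨?_, ?_⟩
  · rw [← setExpect_const q (-a)]
    exact setExpect_mono q fun A _ => (abs_le.mp (h A)).1
  · rw [← setExpect_const q a]
    exact setExpect_mono q fun A _ => (abs_le.mp (h A)).2

/-- The sum of the utilities of all sets of items, an integrable bound of every utility. -/
def envelope (f : Finset E → (E → O) → ℝ≥0) (φ : E → O) : ℝ := ∑ A, (f A φ : ℝ)

theorem le_envelope (f : Finset E → (E → O) → ℝ≥0) (A : Finset E) (φ : E → O) :
    (f A φ : ℝ) ≤ envelope f φ :=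
  Finset.single_le_sum (f := fun A => (f A φ : ℝ)) (fun _ _ => NNReal.coe_nonneg _)
    (Finset.mem_univ A)

theorem envelope_nonneg (f : Finset E → (E → O) → ℝ≥0) (φ : E → O) : 0 ≤ envelope f φ :=
  Finset.sum_nonneg fun _ _ => NNReal.coe_nonneg _

theorem FiniteExpectation.envelope {f : Finset E → (E → O) → ℝ≥0} {p : PMF (E → O)}
    (hfin : FiniteExpectation f p) : HasExpectation p (envelope f) :=
  HasExpectation.sum fun A _ => hfin A

theorem FiniteExpectation.hasExpectation {f : Finset E → (E → O) → ℝ≥0} {p : PMF (E → O)}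
    (hfin : FiniteExpectation f p) {F : (E → O) → ℝ} (a : ℝ)
    (h : ∀ φ, |F φ| ≤ AdaptiveSubmodular.envelope f φ + a) : HasExpectation p F :=
  (hfin.envelope.add (hasExpectation_const a)).of_abs_le h

variable [DecidableEq E]

/-! ### Partial realizations -/

theorem mem_dom {ψ : PartialRealization E O} {e : E} : e ∈ dom ψ ↔ ∃ o, ψ e = some o := by
  simp [dom, Option.isSome_iff_exists]

theorem notMem_dom {ψ : PartialRealization E O} {e : E} : e ∉ dom ψ ↔ ψ e = none := by
  simp [dom]

theorem dom_none : dom (fun _ => none : PartialRealization E O) = ∅ := by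
  simp [dom]

theorem dom_update (ψ : PartialRealization E O) (e : E) (o : O) :
    dom (Function.update ψ e (some o)) = insert e (dom ψ) := by
  ext a
  by_cases h : a = e <;> simp [dom, Function.update_apply, h]

theorem consistent_none (φ : E → O) : Consistent (fun _ => none) φ := by
  intro e o h
  simp at h

theorem consistent_update {ψ : PartialRealization E O} {e : E} (he : ψ e = none) {o : O}
    {φ : E → O} :
    Consistent (Function.update ψ e (some o)) φ ↔ Consistent ψ φ ∧ φ e = o := by
  constructor
  · refine fun h => ⟨fun a o' ha => h a o' ?_, h e o (by simp)⟩
    rwa [Function.update_of_ne]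
    rintro rfl
    simp [he] at ha
  · rintro ⟨h, rfl⟩ a o' ha
    by_cases hae : a = e
    · subst hae
      simpa using ha
    · rw [Function.update_of_ne hae] at ha
      exact h a o' ha

theorem SubRealization.refl (ψ : PartialRealization E O) : SubRealization ψ ψ :=
  fun _ _ h => h

theorem SubRealization.trans {ψ₁ ψ₂ ψ₃ : PartialRealization E O} (h : SubRealization ψ₁ ψ₂)
    (h' : SubRealization ψ₂ ψ₃) : SubRealization ψ₁ ψ₃ :=
  fun e o he => h' e o (h e o he)

theorem subRealization_update {ψ : PartialRealization E O} {e : E} (he : ψ e = none) (o : O) :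
    SubRealization ψ (Function.update ψ e (some o)) := by
  intro a o' ha
  rwa [Function.update_of_ne]
  rintro rfl
  simp [he] at ha

theorem none_subRealization (ψ : PartialRealization E O) : SubRealization (fun _ => none) ψ := by
  intro e o h
  simp at h

theorem SubRealization.dom_subset {ψ ψ' : PartialRealization E O} (h : SubRealization ψ ψ') :
    dom ψ ⊆ dom ψ' := by
  intro e he
  obtain ⟨o, ho⟩ := mem_dom.mp he
  exact mem_dom.mpr ⟨o, h e o ho⟩

theorem prob_eq_expectOn (p : PMF (E → O)) (ψ : PartialRealization E O) :
    prob p ψ = expectOn p {φ | Consistent ψ φ} fun _ => 1 := by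
  simp [prob, expectOn]

theorem prob_pos {p : PMF (E → O)} {ψ : PartialRealization E O} {φ : E → O} (hφ : p φ ≠ 0)
    (h : Consistent ψ φ) : 0 < prob p ψ := by
  have hs : Summable (Set.indicator {φ | Consistent ψ φ} fun φ => (p φ).toReal) :=
    (hasSum_toReal_pmf p).summable.indicator _
  refine hs.tsum_pos (fun a => Set.indicator_nonneg (fun _ _ => ENNReal.toReal_nonneg) a) φ ?_
  rw [Set.indicator_of_mem (show φ ∈ {φ | Consistent ψ φ} from h)]
  exact ENNReal.toReal_pos hφ (p.apply_ne_top φ)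

theorem prob_nonneg (p : PMF (E → O)) (ψ : PartialRealization E O) : 0 ≤ prob p ψ := by
  rw [prob_eq_expectOn]
  exact expectOn_nonneg fun _ _ => zero_le_one

theorem expectOn_consistent_const (p : PMF (E → O)) (ψ : PartialRealization E O) (a : ℝ) :
    expectOn p {φ | Consistent ψ φ} (fun _ => a) = prob p ψ * a := by
  have h := expectOn_const_mul (p := p) (C := {φ | Consistent ψ φ}) (F := fun _ => 1) a
  rw [prob_eq_expectOn, mul_comm, ← h]
  simp

/-- Multiplying by `prob p ψ` clears the denominator of the conditional expectation. When that
probability is zero both sides vanish, so no positivity assumption is needed. -/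
theorem expectOn_marginal {f : Finset E → (E → O) → ℝ≥0} {p : PMF (E → O)} (e : E)
    (ψ : PartialRealization E O) :
    expectOn p {φ | Consistent ψ φ} (fun _ => marginal f p e ψ) =
      expectOn p {φ | Consistent ψ φ}
        fun φ => (f (insert e (dom ψ)) φ : ℝ) - f (dom ψ) φ := by
  rw [expectOn_consistent_const]
  by_cases h : prob p ψ = 0
  · rw [h, zero_mul, eq_comm]
    have : ∀ φ ∈ {φ | Consistent ψ φ}, p φ ≠ 0 →
        (f (insert e (dom ψ)) φ : ℝ) - f (dom ψ) φ = 0 :=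
      fun φ hφ hp => absurd h (prob_pos hp hφ).ne'
    rw [expectOn_congr this]
    simp [expectOn]
  · rw [marginal, mul_div_cancel₀ _ h, Finset.union_comm, ← Finset.insert_eq]
    rfl

/-- The combination of two observations; `ψ` takes precedence. -/
def merge (ψ η : PartialRealization E O) : PartialRealization E O :=
  fun e => (ψ e).orElse fun _ => η e

theorem dom_merge (ψ η : PartialRealization E O) : dom (merge ψ η) = dom ψ ∪ dom η := by
  ext e
  cases h : ψ e <;> simp [dom, merge, h]

theorem subRealization_merge (ψ η : PartialRealization E O) :
    SubRealization ψ (merge ψ η) := by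
  intro e o h
  simp [merge, h]

/-- The common extension `φ₀` forces `ψ` and `η` to agree where both are defined, so giving
precedence to `ψ` loses nothing. -/
theorem consistent_merge {ψ η : PartialRealization E O} {φ₀ : E → O} (h₀ : Consistent ψ φ₀)
    (h₀' : Consistent η φ₀) {φ : E → O} :
    Consistent (merge ψ η) φ ↔ Consistent ψ φ ∧ Consistent η φ := by
  constructor
  · refine fun h => ⟨fun e o he => h e o (subRealization_merge ψ η e o he), fun e o he => ?_⟩
    cases hψ : ψ e with
    | none => exact h e o (by simp [merge, hψ, he])
    | some o' =>
      rw [h e o' (by simp [merge, hψ]), ← h₀ e o' hψ, h₀' e o he]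
  · rintro ⟨h, h'⟩ e o he
    cases hψ : ψ e with
    | none => exact h' e o (by simpa [merge, hψ] using he)
    | some o' =>
      have : o' = o := by simpa [merge, hψ] using he
      rw [h e o' hψ, this]

/-! ### The gain of a policy that is run after an observation -/

theorem setExpect_runFrom_succ (g : PartialRealization E O → PMF (Option E)) (φ : E → O) (n : ℕ)
    (η : PartialRealization E O) (H : Finset E → ℝ) :
    setExpect ((runFrom g φ (n + 1) η).map dom) H =
      (g η none).toReal * H (dom η) + ∑ e, (g η (some e)).toReal *
        setExpect ((runFrom g φ n (Function.update η e (some (φ e)))).map dom) H := by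
  rw [runFrom, PMF.map_bind, setExpect_bind, tsum_fintype, Fintype.sum_option]
  simp [PMF.pure_map, setExpect_pure]

/-- After the observation `ψ`, the utility gained by running a policy is at most the expected sum
of upper bounds `D` of the marginal utilities with respect to `ψ`. -/
theorem expectOn_runFrom_le {f : Finset E → (E → O) → ℝ≥0} {p : PMF (E → O)}
    (hfin : FiniteExpectation f p) (hf : IsAdaptiveSubmodular f p)
    (g : PartialRealization E O → PMF (Option E))
    (hg : ∀ η e, some e ∈ (g η).support → η e = none)
    (ψ : PartialRealization E O) (D : E → ℝ) (hD : ∀ e, 0 ≤ D e)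
    (hψ : ∀ e ∉ dom ψ, marginal f p e ψ ≤ D e) (n : ℕ) (η : PartialRealization E O) :
    expectOn p {φ | Consistent ψ φ ∧ Consistent η φ} (fun φ =>
        setExpect ((runFrom g φ n η).map dom) fun A => f (dom ψ ∪ A) φ - ∑ e ∈ A, D e) ≤
      expectOn p {φ | Consistent ψ φ ∧ Consistent η φ} fun φ =>
        (f (dom ψ ∪ dom η) φ : ℝ) - ∑ e ∈ dom η, D e := by
  have bd : ∀ (A : Finset E) (φ : E → O),
      |(f (dom ψ ∪ A) φ : ℝ) - ∑ e ∈ A, D e| ≤ envelope f φ + ∑ e, D e := by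
    intro A φ
    have h1 := le_envelope f (dom ψ ∪ A) φ
    have h2 : ∑ e ∈ A, D e ≤ ∑ e, D e :=
      Finset.sum_le_sum_of_subset_of_nonneg (Finset.subset_univ A) fun e _ _ => hD e
    have h3 : 0 ≤ ∑ e ∈ A, D e := Finset.sum_nonneg fun e _ => hD e
    have h4 : (0 : ℝ) ≤ f (dom ψ ∪ A) φ := NNReal.coe_nonneg _
    rw [abs_le]
    constructor <;> linarith
  have int0 : ∀ A : Finset E, HasExpectation p fun φ =>
      (f (dom ψ ∪ A) φ : ℝ) - ∑ e ∈ A, D e :=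
    fun A => hfin.hasExpectation _ (bd A)
  have int1 : ∀ q : (E → O) → PMF (Finset E), HasExpectation p fun φ =>
      setExpect (q φ) fun A => f (dom ψ ∪ A) φ - ∑ e ∈ A, D e :=
    fun q => hfin.hasExpectation _ fun φ => abs_setExpect_le _ fun A => bd A φ
  -- The quantity `f (dom ψ ∪ dom η) - ∑ e ∈ dom η, D e` is a supermartingale along the run, given
  -- `ψ`; this holds for any number of steps and any current observation `η`.
  induction n generalizing η with
  | zero => simp [runFrom, PMF.pure_map, setExpect_pure]
  | succ n ih =>
    set C : Set (E → O) := {φ | Consistent ψ φ ∧ Consistent η φ} with hC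
    have step : ∀ e, η e = none →
        expectOn p C (fun φ =>
          setExpect ((runFrom g φ n (Function.update η e (some (φ e)))).map dom)
            fun A => f (dom ψ ∪ A) φ - ∑ e ∈ A, D e) ≤
        expectOn p C fun φ => (f (dom ψ ∪ dom η) φ : ℝ) - ∑ e ∈ dom η, D e := by
      intro e he
      have h1 : expectOn p C (fun φ =>
          setExpect ((runFrom g φ n (Function.update η e (some (φ e)))).map dom)
            fun A => f (dom ψ ∪ A) φ - ∑ e ∈ A, D e) ≤
          expectOn p C fun φ => (f (dom ψ ∪ insert e (dom η)) φ : ℝ) -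
            ∑ e ∈ insert e (dom η), D e := by
        -- The next observation depends on the revealed state of `e`, so the induction hypothesis is
        -- applied separately for each state.
        refine expectOn_le_of_fiberwise (fun φ => φ e) (int1 _) (int0 _) fun o => ?_
        have hset : C ∩ (fun φ : E → O => φ e) ⁻¹' {o} =
            {φ | Consistent ψ φ ∧ Consistent (Function.update η e (some o)) φ} := by
          ext φ
          simp [hC, consistent_update he, and_assoc]
        have h := ih (Function.update η e (some o))
        rw [dom_update] at h
        rw [hset]
        refine le_of_eq_of_le (expectOn_congr fun φ hφ _ => ?_) h
        rw [((consistent_update he).mp hφ.2).2]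
      refine h1.trans ?_
      have hne : e ∉ dom η := notMem_dom.mpr he
      by_cases heψ : e ∈ dom ψ
      -- An item already observed in `ψ` adds no utility, and only `D e ≥ 0` is subtracted.
      · refine expectOn_mono (int0 _) (int0 _) fun φ _ _ => ?_
        rw [Finset.sum_insert hne, Finset.union_insert,
          Finset.insert_eq_of_mem (Finset.mem_union_left _ heψ)]
        linarith [hD e]
      -- If the event is not null, it is conditioning on `merge ψ η`, an extension of `ψ`; adaptive
      -- submodularity then bounds the marginal utility of `e` by `D e`.
      · by_cases hex : ∃ φ₀ ∈ C, p φ₀ ≠ 0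
        · obtain ⟨φ₀, hφ₀, hp₀⟩ := hex
          have hset : C = {φ | Consistent (merge ψ η) φ} := by
            ext φ
            exact (consistent_merge hφ₀.1 hφ₀.2).symm
          have hmem : e ∉ dom (merge ψ η) := by
            rw [dom_merge, Finset.mem_union]
            tauto
          have hpr : 0 < prob p (merge ψ η) :=
            prob_pos hp₀ ((consistent_merge hφ₀.1 hφ₀.2).mpr hφ₀)
          have hle : marginal f p e (merge ψ η) ≤ D e :=
            (hf _ _ (subRealization_merge ψ η) hpr e hmem).trans (hψ e heψ)
          have hm := expectOn_marginal (f := f) (p := p) e (merge ψ η)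
          rw [← hset, dom_merge, ← Finset.union_insert] at hm
          have hc : expectOn p C (fun _ => marginal f p e (merge ψ η)) ≤
              expectOn p C fun _ => D e :=
            expectOn_mono (hasExpectation_const _) (hasExpectation_const _) fun _ _ _ => hle
          have e1 := expectOn_sub (C := C) (int0 (insert e (dom η))) (int0 (dom η))
          have e2 := expectOn_sub (C := C)
            (HasExpectation.sub (hfin (dom ψ ∪ insert e (dom η))) (hfin (dom ψ ∪ dom η)))
            (hasExpectation_const (D e))
          have e3 : expectOn p C (fun φ =>
              ((f (dom ψ ∪ insert e (dom η)) φ : ℝ) - ∑ e ∈ insert e (dom η), D e) -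
                (f (dom ψ ∪ dom η) φ - ∑ e ∈ dom η, D e)) =
              expectOn p C fun φ => ((f (dom ψ ∪ insert e (dom η)) φ : ℝ) -
                f (dom ψ ∪ dom η) φ) - D e := by
            refine expectOn_congr fun φ _ _ => ?_
            rw [Finset.sum_insert hne]
            ring
          linarith
        · push Not at hex
          exact (expectOn_congr fun φ hφ hp => absurd (hex φ hφ) hp).le
    have hsum : (g η none).toReal + ∑ e, (g η (some e)).toReal = 1 := by
      have h := (hasSum_toReal_pmf (g η)).tsum_eq
      rwa [tsum_fintype, Fintype.sum_option] at h
    simp only [setExpect_runFrom_succ]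
    rw [expectOn_add ((int0 _).const_mul _)
        (HasExpectation.sum fun e _ => (int1 _).const_mul _), expectOn_const_mul,
      expectOn_sum fun e _ => (int1 _).const_mul _]
    simp only [expectOn_const_mul]
    set I := expectOn p C fun φ => (f (dom ψ ∪ dom η) φ : ℝ) - ∑ e ∈ dom η, D e
    calc _ ≤ (g η none).toReal * I + ∑ e, (g η (some e)).toReal * I := by
          refine add_le_add le_rfl (Finset.sum_le_sum fun e _ => ?_)
          by_cases hge : g η (some e) = 0
          · simp [hge]
          · exact mul_le_mul_of_nonneg_left
              (step e (hg η e ((PMF.mem_support_iff _ _).mpr hge))) ENNReal.toReal_nonneg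
      _ = I := by rw [← Finset.sum_mul, ← add_mul, hsum, one_mul]

/-! ### Runs of deterministic rules -/

/-- The observation obtained from `η` by at most `n` further selections of the rule `g`. -/
def detRun (g : PartialRealization E O → Option E) (φ : E → O) :
    ℕ → PartialRealization E O → PartialRealization E O
  | 0, η => η
  | n + 1, η => match g η with
    | none => η
    | some e => detRun g φ n (Function.update η e (some (φ e)))

/-- The marginal utility of `e` at the time of its selection in a run of the rule `g`; it is zero
if `e` is not selected. -/
def itemGain (f : Finset E → (E → O) → ℝ≥0) (p : PMF (E → O))
    (g : PartialRealization E O → Option E) (φ : E → O) (e : E) :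
    ℕ → PartialRealization E O → ℝ
  | 0, _ => 0
  | n + 1, η => match g η with
    | none => 0
    | some e' => (if e' = e then marginal f p e η else 0) +
        itemGain f p g φ e n (Function.update η e' (some (φ e')))

/-- The sum of the marginal utilities collected in a run of the rule `g`. -/
def totalGain (f : Finset E → (E → O) → ℝ≥0) (p : PMF (E → O))
    (g : PartialRealization E O → Option E) (φ : E → O) (n : ℕ)
    (η : PartialRealization E O) : ℝ :=
  ∑ e, itemGain f p g φ e n η

section DeterministicRule

variable {f : Finset E → (E → O) → ℝ≥0} {p : PMF (E → O)}
  {g : PartialRealization E O → Option E} {φ : E → O} {n : ℕ} {η : PartialRealization E O}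

theorem runFrom_pure (g : PartialRealization E O → Option E) (φ : E → O) (n : ℕ)
    (η : PartialRealization E O) :
    runFrom (fun η => PMF.pure (g η)) φ n η = PMF.pure (detRun g φ n η) := by
  induction n generalizing η with
  | zero => rfl
  | succ n ih =>
    rw [runFrom, PMF.pure_bind, detRun]
    cases g η with
    | none => rfl
    | some e => exact ih _

theorem detRun_succ_none (h : g η = none) : detRun g φ (n + 1) η = η := by
  simp [detRun, h]

theorem detRun_succ_some {e : E} (h : g η = some e) :
    detRun g φ (n + 1) η = detRun g φ n (Function.update η e (some (φ e))) := by
  simp [detRun, h]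

theorem itemGain_succ_none {e : E} (h : g η = none) : itemGain f p g φ e (n + 1) η = 0 := by
  simp [itemGain, h]

theorem itemGain_succ_some {e e' : E} (h : g η = some e') :
    itemGain f p g φ e (n + 1) η = (if e' = e then marginal f p e η else 0) +
      itemGain f p g φ e n (Function.update η e' (some (φ e'))) := by
  simp [itemGain, h]

theorem totalGain_succ_none (h : g η = none) : totalGain f p g φ (n + 1) η = 0 := by
  simp [totalGain, itemGain_succ_none h]

theorem totalGain_succ_some {e : E} (h : g η = some e) :
    totalGain f p g φ (n + 1) η = marginal f p e η +
      totalGain f p g φ n (Function.update η e (some (φ e))) := by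
  simp [totalGain, itemGain_succ_some h, Finset.sum_add_distrib]

theorem subRealization_detRun (hg : ∀ η e, g η = some e → η e = none) :
    SubRealization η (detRun g φ n η) := by
  induction n generalizing η with
  | zero => exact SubRealization.refl η
  | succ n ih =>
    cases h : g η with
    | none => rw [detRun_succ_none h]; exact SubRealization.refl η
    | some e =>
      rw [detRun_succ_some h]
      exact (subRealization_update (hg η e h) _).trans ih

theorem consistent_detRun (hg : ∀ η e, g η = some e → η e = none) (hη : Consistent η φ) :
    Consistent (detRun g φ n η) φ := by
  induction n generalizing η with
  | zero => exact hη
  | succ n ih =>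
    cases h : g η with
    | none => rwa [detRun_succ_none h]
    | some e =>
      rw [detRun_succ_some h]
      exact ih ((consistent_update (hg η e h)).mpr ⟨hη, rfl⟩)

/-- A realization that is consistent with the final observation of a run leads to the same run. -/
theorem detRun_eq_of_consistent (hg : ∀ η e, g η = some e → η e = none) {φ' : E → O}
    (h' : Consistent (detRun g φ n η) φ') :
    detRun g φ' n η = detRun g φ n η := by
  induction n generalizing η with
  | zero => rfl
  | succ n ih =>
    cases h : g η with
    | none => rw [detRun_succ_none h, detRun_succ_none h]
    | some e =>
      rw [detRun_succ_some h] at h' ⊢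
      have : φ' e = φ e :=
        h' e (φ e) (subRealization_detRun hg e (φ e) (by simp))
      rw [detRun_succ_some h, this, ih h']

theorem itemGain_nonneg (hpos : ∀ η e, g η = some e → 0 ≤ marginal f p e η) (e : E) :
    0 ≤ itemGain f p g φ e n η := by
  induction n generalizing η with
  | zero => exact le_rfl
  | succ n ih =>
    cases h : g η with
    | none => rw [itemGain_succ_none h]
    | some e' =>
      rw [itemGain_succ_some h]
      refine add_nonneg ?_ ih
      split_ifs with he
      · exact hpos η e (he ▸ h)
      · exact le_rfl

theorem itemGain_eq_zero {e : E} (hg : ∀ η, g η ≠ some e) : itemGain f p g φ e n η = 0 := by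
  induction n generalizing η with
  | zero => rfl
  | succ n ih =>
    cases h : g η with
    | none => rw [itemGain_succ_none h]
    | some e' =>
      rw [itemGain_succ_some h, if_neg, ih, add_zero]
      rintro rfl
      exact hg η h

/-- The factor `n` is crude, since a fresh item is selected at most once, but a bound uniform in `φ`
suffices for integrability. -/
theorem itemGain_le {K : ℝ} (hK : 0 ≤ K) (hb : ∀ η e, g η = some e → marginal f p e η ≤ K)
    (e : E) : itemGain f p g φ e n η ≤ n * K := by
  induction n generalizing η with
  | zero => simp [itemGain]
  | succ n ih =>
    push_cast
    have h0 : (0 : ℝ) ≤ n * K := by positivity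
    cases h : g η with
    | none => rw [itemGain_succ_none h]; linarith
    | some e' =>
      rw [itemGain_succ_some h]
      have h1 := ih (η := Function.update η e' (some (φ e')))
      have h2 : (if e' = e then marginal f p e η else 0) ≤ K := by
        split_ifs with he
        · exact hb η e (he ▸ h)
        · exact hK
      linarith

end DeterministicRule

/-! ### The greedy rule -/

section Greedy

variable {f : Finset E → (E → O) → ℝ≥0} {p : PMF (E → O)} {c : E → ℝ} {b : ℝ}
  {rank : PartialRealization E O → E ↪ ℕ} {S : Finset E} {η : PartialRealization E O} {e : E}

theorem IsGreedyChoice.eq {e' : E} (h : IsGreedyChoice f p c b rank S η e)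
    (h' : IsGreedyChoice f p c b rank S η e') : e = e' := by
  rcases h.2 e' h'.1 with h1 | ⟨h1, h2⟩ <;> rcases h'.2 e h.1 with h3 | ⟨h3, h4⟩
  · exact absurd h1 h3.asymm
  · exact absurd h1 h3.not_gt.elim
  · exact absurd h3 h1.not_gt.elim
  · exact (rank η).injective (le_antisymm h2 h4)

theorem greedyNext_eq_some :
    greedyNext f p c b rank S η = some e ↔ IsGreedyChoice f p c b rank S η e := by
  unfold greedyNext
  constructor
  · intro h
    split_ifs at h with hex
    rw [← Option.some.inj h]
    exact hex.choose_spec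
  · intro h
    have hex : ∃ e, IsGreedyChoice f p c b rank S η e := ⟨e, h⟩
    rw [dif_pos hex, hex.choose_spec.eq h]

theorem exists_isGreedyChoice (h : (candidates f p c b S η).Nonempty) :
    ∃ e, IsGreedyChoice f p c b rank S η e := by
  obtain ⟨e₁, h₁, hmax⟩ := (Set.toFinite (candidates f p c b S η)).exists_maximalFor
    (fun e => marginal f p e η / c e) _ h
  -- Among the candidates of maximal density, take the one of smallest rank.
  obtain ⟨e₂, ⟨h₂, h₂'⟩, hmin⟩ := (Set.toFinite {e | e ∈ candidates f p c b S η ∧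
    marginal f p e₁ η / c e₁ ≤ marginal f p e η / c e}).exists_minimalFor (rank η) _
      ⟨e₁, h₁, le_rfl⟩
  refine ⟨e₂, h₂, fun e' he' => ?_⟩
  have key : ∀ e ∈ candidates f p c b S η,
      marginal f p e η / c e ≤ marginal f p e₁ η / c e₁ := fun e he => by
    by_contra hlt
    exact hlt (hmax he (not_le.mp hlt).le)
  rcases lt_or_ge (marginal f p e' η / c e') (marginal f p e₂ η / c e₂) with hlt | hge
  · exact Or.inl hlt
  · refine Or.inr ⟨le_antisymm ((key e' he').trans h₂') hge, ?_⟩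
    by_contra hr
    exact hr (hmin ⟨he', h₂'.trans hge⟩ (not_le.mp hr).le)

theorem greedyNext_fresh (h : greedyNext f p c b rank S η = some e) : η e = none :=
  notMem_dom.mp (greedyNext_eq_some.mp h).1.2.1

theorem greedyNext_mem (h : greedyNext f p c b rank S η = some e) : e ∈ S :=
  (greedyNext_eq_some.mp h).1.1

theorem marginal_pos_of_greedyNext (h : greedyNext f p c b rank S η = some e) :
    0 < marginal f p e η :=
  (greedyNext_eq_some.mp h).1.2.2.2

/-- Removing a competitor that was not chosen leaves the choice unchanged. It matters here that
`rank` may depend on the observation but not on `S`. -/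
theorem greedyNext_of_insert {e' : E} (hne : e' ≠ e)
    (h : greedyNext f p c b rank (insert e S) η = some e') :
    greedyNext f p c b rank S η = some e' := by
  obtain ⟨⟨hm, hrest⟩, hmax⟩ := greedyNext_eq_some.mp h
  refine greedyNext_eq_some.mpr
    ⟨⟨(Finset.mem_insert.mp hm).resolve_left hne, hrest⟩, fun a ha => hmax a ?_⟩
  exact ⟨Finset.mem_insert_of_mem ha.1, ha.2⟩

theorem marginal_le_max (hf : IsAdaptiveSubmodular f p) (he : e ∉ dom η) :
    marginal f p e η ≤ max 0 (marginal f p e fun _ => none) := by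
  -- At probability zero `marginal` is a division by zero, hence `0`; this is covered by the maximum
  -- with `0`.
  rcases (prob_nonneg p η).eq_or_lt with h | h
  · rw [marginal, ← h, div_zero]
    exact le_max_left _ _
  · exact (hf _ _ (none_subRealization η) h e he).trans (le_max_right _ _)

/-- A bound of all marginal utilities. -/
def marginalBound (f : Finset E → (E → O) → ℝ≥0) (p : PMF (E → O)) : ℝ :=
  ∑ e, max 0 (marginal f p e fun _ => none)

theorem marginalBound_nonneg : 0 ≤ marginalBound f p :=
  Finset.sum_nonneg fun _ _ => le_max_left _ _

theorem marginal_le_marginalBound (hf : IsAdaptiveSubmodular f p) (he : e ∉ dom η) :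
    marginal f p e η ≤ marginalBound f p :=
  (marginal_le_max hf he).trans (Finset.single_le_sum
    (f := fun e => max 0 (marginal f p e fun _ => none)) (fun _ _ => le_max_left _ _)
    (Finset.mem_univ e))

theorem hasExpectation_itemGain (hf : IsAdaptiveSubmodular f p) (e : E) (n : ℕ)
    (η : (E → O) → PartialRealization E O) :
    HasExpectation p fun φ => itemGain f p (greedyNext f p c b rank S) φ e n (η φ) := by
  refine (hasExpectation_const (n * marginalBound f p)).of_abs_le fun φ => ?_
  rw [abs_of_nonneg (itemGain_nonneg (fun η e h => (marginal_pos_of_greedyNext h).le) e)]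
  exact itemGain_le marginalBound_nonneg
    (fun η e h => marginal_le_marginalBound hf (notMem_dom.mpr (greedyNext_fresh h))) e

theorem hasExpectation_totalGain (hf : IsAdaptiveSubmodular f p) (n : ℕ)
    (η : (E → O) → PartialRealization E O) :
    HasExpectation p fun φ => totalGain f p (greedyNext f p c b rank S) φ n (η φ) :=
  HasExpectation.sum fun e _ => hasExpectation_itemGain hf e n η

theorem hasExpectation_apply (hfin : FiniteExpectation f p) (A : (E → O) → Finset E) :
    HasExpectation p fun φ => (f (A φ) φ : ℝ) :=
  hfin.hasExpectation 0 fun φ => by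
    rw [abs_of_nonneg (NNReal.coe_nonneg _), add_zero]
    exact le_envelope f _ φ

/-- The marginal utilities collected by the greedy rule add up to its expected utility. -/
theorem expectOn_totalGain_le (hfin : FiniteExpectation f p) (hf : IsAdaptiveSubmodular f p)
    (n : ℕ) (η : PartialRealization E O) :
    expectOn p {φ | Consistent η φ}
        (fun φ => totalGain f p (greedyNext f p c b rank S) φ n η) ≤
      expectOn p {φ | Consistent η φ} fun φ =>
        (f (dom (detRun (greedyNext f p c b rank S) φ n η)) φ : ℝ) - f (dom η) φ := by
  induction n generalizing η with
  | zero => simp [totalGain, itemGain, detRun]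
  | succ n ih =>
    cases h : greedyNext f p c b rank S η with
    | none => simp [totalGain_succ_none h, detRun_succ_none h]
    | some e =>
      simp only [totalGain_succ_some h, detRun_succ_some h]
      set g := greedyNext f p c b rank S
      have he := greedyNext_fresh h
      have h1 : expectOn p {φ | Consistent η φ}
          (fun φ => totalGain f p g φ n (Function.update η e (some (φ e)))) ≤
          expectOn p {φ | Consistent η φ} fun φ =>
            (f (dom (detRun g φ n (Function.update η e (some (φ e))))) φ : ℝ) -
              f (insert e (dom η)) φ := by
        refine expectOn_le_of_fiberwise (fun φ => φ e) (hasExpectation_totalGain hf n _)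
          ((hasExpectation_apply hfin _).sub (hasExpectation_apply hfin _)) fun o => ?_
        have hset : {φ | Consistent η φ} ∩ (fun φ : E → O => φ e) ⁻¹' {o} =
            {φ | Consistent (Function.update η e (some o)) φ} := by
          ext φ
          simp [consistent_update he]
        have h2 := ih (Function.update η e (some o))
        rw [dom_update] at h2
        rw [hset]
        refine le_of_eq_of_le (expectOn_congr fun φ hφ _ => ?_)
          (h2.trans_eq (expectOn_congr fun φ hφ _ => ?_))
        · rw [((consistent_update he).mp hφ).2]
        · rw [((consistent_update he).mp hφ).2]
      -- On the event of observing `η`, the conditional marginal and the actual increment of `f`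
      -- have the same expectation; the increments then telescope.
      have h2 := expectOn_marginal (f := f) (p := p) e η
      rw [expectOn_add (hasExpectation_const _) (hasExpectation_totalGain hf n _), h2]
      refine (add_le_add le_rfl h1).trans_eq ?_
      rw [← expectOn_add ((hasExpectation_apply hfin _).sub (hasExpectation_apply hfin _))
        ((hasExpectation_apply hfin _).sub (hasExpectation_apply hfin _))]
      exact expectOn_congr fun φ _ _ => by ring

/-- An item with a positive marginal utility at the end of a greedy run has either been passed
over because it was not sampled, or it has been crowded out by items of larger density. -/
theorem itemGain_or_totalGain_ge (hf : IsAdaptiveSubmodular f p) (hc : ∀ e, 0 < c e)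
    {φ : E → O} (hφ : p φ ≠ 0) (n : ℕ) (η ψ : PartialRealization E O) (hη : Consistent η φ)
    (hn : Fintype.card E ≤ n + (dom η).card)
    (hψ : detRun (greedyNext f p c b rank S) φ n η = ψ) (he : e ∉ dom ψ)
    (hpos : 0 < marginal f p e ψ) :
    (e ∉ S ∧ marginal f p e ψ ≤
        itemGain f p (greedyNext f p c b rank (insert e S)) φ e n η) ∨
      marginal f p e ψ * (b - c e - ∑ i ∈ dom η, c i) ≤
        c e * totalGain f p (greedyNext f p c b rank S) φ n η := by
  have fresh : ∀ η e, greedyNext f p c b rank S η = some e → η e = none :=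
    fun η e => greedyNext_fresh
  induction n generalizing η with
  | zero =>
    rw [detRun] at hψ
    subst hψ
    -- With no steps left, `hn` says that every item has been observed, contradicting `e ∉ dom ψ`.
    have : dom η = Finset.univ :=
      Finset.eq_univ_of_card _ (le_antisymm (Finset.card_le_univ _) (by simpa using hn))
    simp [this] at he
  | succ n ih =>
    have hsub : SubRealization η ψ := hψ ▸ subRealization_detRun fresh
    have hcon : Consistent ψ φ := hψ ▸ consistent_detRun fresh hη
    have heη : e ∉ dom η := fun h => he (hsub.dom_subset h)
    have hmar : marginal f p e ψ ≤ marginal f p e η := hf _ _ hsub (prob_pos hφ hcon) e he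
    have gain_nonneg : ∀ (T : Finset E) (n : ℕ) (e : E) (η : PartialRealization E O),
        0 ≤ itemGain f p (greedyNext f p c b rank T) φ e n η :=
      fun T n e η => itemGain_nonneg (fun η e h => (marginal_pos_of_greedyNext h).le) e
    by_cases hfit : c e ≤ b - ∑ i ∈ dom η, c i
    -- Since `Δ(e ∣ η) ≥ Δ(e ∣ ψ) > 0`, the item `e` is a candidate of the run on `insert e S` as
    -- long as it fits.
    · have hcand : e ∈ candidates f p c b (insert e S) η :=
        ⟨Finset.mem_insert_self e S, heη, hfit, hpos.trans_le hmar⟩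
      obtain ⟨e', hch⟩ := exists_isGreedyChoice (rank := rank) ⟨e, hcand⟩
      have hnext := greedyNext_eq_some.mpr hch
      by_cases hee : e' = e
      · subst hee
        refine Or.inl ⟨fun heS => ?_, ?_⟩
        · rw [Finset.insert_eq_of_mem heS] at hnext
          rw [detRun_succ_some hnext] at hψ
          refine he ((hψ ▸ subRealization_detRun fresh :
            SubRealization (Function.update η e' (some (φ e'))) ψ).dom_subset ?_)
          rw [dom_update]
          exact Finset.mem_insert_self _ _
        · rw [itemGain_succ_some hnext, if_pos rfl]
          linarith [gain_nonneg (insert e' S) n e' (Function.update η e' (some (φ e')))]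
      -- Both runs select the same `e'`, whose density is at least that of `e`; its gain times `c e`
      -- pays for the budget `c e'` that it uses.
      · have hS := greedyNext_of_insert hee hnext
        have he'η : e' ∉ dom η := notMem_dom.mpr (greedyNext_fresh hS)
        rw [detRun_succ_some hS] at hψ
        rw [itemGain_succ_some hnext, if_neg hee, zero_add, totalGain_succ_some hS]
        have hdom := dom_update η e' (φ e')
        refine (ih _ ((consistent_update (greedyNext_fresh hS)).mpr ⟨hη, rfl⟩) ?_ hψ).imp_right
          fun h => ?_
        · rw [hdom, Finset.card_insert_of_notMem he'η]
          omega
        · rw [hdom, Finset.sum_insert he'η] at h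
          have hden : marginal f p e η / c e ≤ marginal f p e' η / c e' := by
            rcases hch.2 e hcand with h | h
            · exact h.le
            · exact h.1.le
          rw [div_le_div_iff₀ (hc e) (hc e')] at hden
          have := mul_le_mul_of_nonneg_right hmar (hc e').le
          linarith
    · refine Or.inr ?_
      -- Once `e` no longer fits, the left side is nonpositive and the gains of the rest of the run
      -- are not needed.
      have h1 : marginal f p e ψ * (b - c e - ∑ i ∈ dom η, c i) ≤ 0 :=
        mul_nonpos_of_nonneg_of_nonpos hpos.le (by linarith)
      exact h1.trans (mul_nonneg (hc e).le (Finset.sum_nonneg fun a _ => gain_nonneg S _ a η))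

end Greedy

/-! ### Comparison with a feasible policy -/

/-- If every item `e` of a set of total cost at most `b` satisfies `d e / c e ≤ G / (b - c e)`,
then the values `d e` sum to at most `G`, apart from a single item of largest cost. -/
theorem sum_le_of_density_le {T : Finset E} {c d : E → ℝ} {b G M : ℝ} (hc : ∀ e, 0 < c e)
    (hG : 0 ≤ G) (hM : 0 ≤ M) (hT : ∑ e ∈ T, c e ≤ b) (hd : ∀ e ∈ T, 0 ≤ d e)
    (hdG : ∀ e ∈ T, d e * (b - c e) ≤ c e * G) (hdM : ∀ e ∈ T, d e ≤ M) :
    ∑ e ∈ T, d e ≤ G + M := by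
  rcases T.eq_empty_or_nonempty with rfl | hne
  · simpa using add_nonneg hG hM
  obtain ⟨m, hm, hmax⟩ := T.exists_max_image c hne
  rw [← Finset.sum_erase_add T d hm]
  rw [← Finset.sum_erase_add T c hm] at hT
  refine add_le_add ?_ (hdM m hm)
  rcases (T.erase m).eq_empty_or_nonempty with h0 | hne'
  · simpa [h0] using hG
  have hK : 0 < ∑ e ∈ T.erase m, c e := Finset.sum_pos (fun e _ => hc e) hne'
  -- The items other than `m` cost in total at most `b - c m ≤ b - c e`, so `d e` times this cost is
  -- at most `c e * G`; summing over `e` and cancelling the cost gives the bound `G`.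
  refine le_of_mul_le_mul_right ?_ hK
  rw [Finset.sum_mul, mul_comm G, Finset.sum_mul]
  refine Finset.sum_le_sum fun e he => ?_
  have heT := Finset.mem_of_mem_erase he
  refine le_trans (mul_le_mul_of_nonneg_left ?_ (hd e heT)) (hdG e heT)
  linarith [hmax e heT]

section Greedy

variable {f : Finset E → (E → O) → ℝ≥0} {p : PMF (E → O)} {c : E → ℝ} {b : ℝ}
  {rank : PartialRealization E O → E ↪ ℕ}

/-- The observation at the end of a greedy run on `S`. -/
def greedyFinal (f : Finset E → (E → O) → ℝ≥0) (p : PMF (E → O)) (c : E → ℝ) (b : ℝ)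
    (rank : PartialRealization E O → E ↪ ℕ) (S : Finset E) (φ : E → O) :
    PartialRealization E O :=
  detRun (greedyNext f p c b rank S) φ (Fintype.card E) fun _ => none

/-- The marginal utility of `e` at the time of its selection in the greedy run on `S`. -/
def greedyGain (f : Finset E → (E → O) → ℝ≥0) (p : PMF (E → O)) (c : E → ℝ) (b : ℝ)
    (rank : PartialRealization E O → E ↪ ℕ) (φ : E → O) (e : E) (S : Finset E) : ℝ :=
  itemGain f p (greedyNext f p c b rank S) φ e (Fintype.card E) fun _ => none

theorem greedyGain_nonneg (φ : E → O) (e : E) (S : Finset E) :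
    0 ≤ greedyGain f p c b rank φ e S :=
  itemGain_nonneg (fun _ _ h => (marginal_pos_of_greedyNext h).le) e

theorem greedyGain_eq_zero (φ : E → O) {e : E} {S : Finset E} (he : e ∉ S) :
    greedyGain f p c b rank φ e S = 0 :=
  itemGain_eq_zero fun _ h => he (greedyNext_mem h)

theorem hasExpectation_greedyGain (hf : IsAdaptiveSubmodular f p) (e : E) (S : Finset E) :
    HasExpectation p fun φ => greedyGain f p c b rank φ e S :=
  hasExpectation_itemGain hf e _ _

theorem marginal_none_le_singletonValue (hfin : FiniteExpectation f p) (e : E) :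
    marginal f p e (fun _ => none) ≤ singletonValue f p e := by
  have h := expectOn_marginal (f := f) (p := p) e fun _ => none
  have hset : {φ : E → O | Consistent (fun _ => none) φ} = Set.univ :=
    Set.eq_univ_of_forall consistent_none
  rw [hset, expectOn_univ_const, dom_none] at h
  rw [h, singletonValue, ← expectOn_univ]
  refine expectOn_mono (HasExpectation.sub (hfin _) (hfin _)) (hfin _) fun φ _ _ => ?_
  have : (0 : ℝ) ≤ f ∅ φ := NNReal.coe_nonneg _
  simp only [insert_empty_eq]
  linarith

theorem singletonValue_nonneg (e : E) : 0 ≤ singletonValue f p e :=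
  tsum_nonneg fun _ => mul_nonneg ENNReal.toReal_nonneg (NNReal.coe_nonneg _)

/-- The positive part of the marginal utility of an item that has not been observed. -/
def residual (f : Finset E → (E → O) → ℝ≥0) (p : PMF (E → O)) (ψ : PartialRealization E O)
    (e : E) : ℝ :=
  if e ∈ dom ψ then 0 else max 0 (marginal f p e ψ)

theorem residual_nonneg (ψ : PartialRealization E O) (e : E) : 0 ≤ residual f p ψ e := by
  unfold residual
  split_ifs
  · exact le_rfl
  · exact le_max_left _ _

/-- The marginal utilities that are left to a feasible set after a greedy run are covered by the
gains of the items that were not sampled, the gains of the run, and the best single item. -/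
theorem sum_residual_le (hfin : FiniteExpectation f p) (hf : IsAdaptiveSubmodular f p)
    (hc : ∀ e, 0 < c e) {eStar : E} (heStar : ∀ e, singletonValue f p e ≤ singletonValue f p eStar)
    {φ : E → O} (hφ : p φ ≠ 0) (S : Finset E) {A : Finset E} (hA : ∑ e ∈ A, c e ≤ b) :
    ∑ e ∈ A, residual f p (greedyFinal f p c b rank S φ) e ≤
      ∑ e ∈ Sᶜ, greedyGain f p c b rank φ e (insert e S) +
        ∑ e, greedyGain f p c b rank φ e S + singletonValue f p eStar := by
  set ψ := greedyFinal f p c b rank S φ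
  have hcon : Consistent ψ φ :=
    consistent_detRun (fun _ _ h => greedyNext_fresh h) (consistent_none φ)
  have key : ∀ e, e ∉ dom ψ → 0 < marginal f p e ψ →
      (e ∉ S ∧ marginal f p e ψ ≤ greedyGain f p c b rank φ e (insert e S)) ∨
        marginal f p e ψ * (b - c e) ≤ c e * ∑ e, greedyGain f p c b rank φ e S := by
    intro e he hpos
    have h := itemGain_or_totalGain_ge (rank := rank) (b := b) (S := S) hf hc hφ
      (Fintype.card E) (fun _ => none) ψ (consistent_none φ) (by simp) rfl he hpos
    rwa [dom_none, Finset.sum_empty, sub_zero] at h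
  -- `P` marks the items charged to the run on `insert e S`; every other item with a positive
  -- residual satisfies the density bound.
  set P : E → Prop := fun e => e ∉ S ∧
    residual f p ψ e ≤ greedyGain f p c b rank φ e (insert e S)
  classical
  rw [← Finset.sum_filter_add_sum_filter_not A P, add_assoc]
  refine add_le_add ?_ ?_
  · calc ∑ e ∈ A with P e, residual f p ψ e
        ≤ ∑ e ∈ A with P e, greedyGain f p c b rank φ e (insert e S) :=
          Finset.sum_le_sum fun e he => (Finset.mem_filter.mp he).2.2
      _ ≤ _ := Finset.sum_le_sum_of_subset_of_nonneg
          (fun e he => Finset.mem_compl.mpr (Finset.mem_filter.mp he).2.1)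
          fun e _ _ => greedyGain_nonneg φ e _
  · have hG : 0 ≤ ∑ e, greedyGain f p c b rank φ e S :=
      Finset.sum_nonneg fun e _ => greedyGain_nonneg φ e S
    have hT : ∑ e ∈ A with ¬ P e, c e ≤ b :=
      (Finset.sum_le_sum_of_subset_of_nonneg (Finset.filter_subset _ _)
        fun e _ _ => (hc e).le).trans hA
    have zero_or : ∀ e, residual f p ψ e = 0 ∨ (e ∉ dom ψ ∧ 0 < marginal f p e ψ ∧
        residual f p ψ e = marginal f p e ψ) := by
      intro e
      unfold residual
      split_ifs with h
      · exact Or.inl rfl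
      · rcases le_or_gt (marginal f p e ψ) 0 with h0 | h0
        · exact Or.inl (max_eq_left h0)
        · exact Or.inr ⟨h, h0, max_eq_right h0.le⟩
    refine sum_le_of_density_le hc hG (singletonValue_nonneg eStar) hT
      (fun e _ => residual_nonneg ψ e) (fun e he => ?_) fun e he => ?_
    · rcases zero_or e with h | ⟨h1, h2, h3⟩
      · rw [h, zero_mul]
        exact mul_nonneg (hc e).le hG
      · rw [h3]
        refine (key e h1 h2).resolve_left fun h => (Finset.mem_filter.mp he).2 ?_
        exact ⟨h.1, h3.trans_le h.2⟩
    · rcases zero_or e with h | ⟨h1, _, h3⟩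
      · rw [h]
        exact singletonValue_nonneg eStar
      · rw [h3]
        exact ((hf _ _ (none_subRealization ψ) (prob_pos hφ hcon) e h1).trans
          (marginal_none_le_singletonValue hfin e)).trans (heStar e)

/-- The utility of the union of the set selected by a feasible rule and the set selected by the
greedy run on `S`. -/
theorem expectOn_union_le (hfin : FiniteExpectation f p) (hf : IsAdaptiveSubmodular f p)
    (hc : ∀ e, 0 < c e) {eStar : E} (heStar : ∀ e, singletonValue f p e ≤ singletonValue f p eStar)
    (g : PartialRealization E O → PMF (Option E))
    (hg : ∀ η e, some e ∈ (g η).support → η e = none)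
    (hfeas : ∀ φ, p φ ≠ 0 →
      ∀ A ∈ ((runFrom g φ (Fintype.card E) fun _ => none).map dom).support, ∑ e ∈ A, c e ≤ b)
    (S : Finset E) :
    expectOn p Set.univ (fun φ =>
        setExpect ((runFrom g φ (Fintype.card E) fun _ => none).map dom) fun A =>
          (f (A ∪ dom (greedyFinal f p c b rank S φ)) φ : ℝ)) ≤
      expectOn p Set.univ fun φ => (f (dom (greedyFinal f p c b rank S φ)) φ : ℝ) +
        (∑ e ∈ Sᶜ, greedyGain f p c b rank φ e (insert e S) +
          ∑ e, greedyGain f p c b rank φ e S + singletonValue f p eStar) := by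
  set R : (E → O) → ℝ := fun φ => ∑ e ∈ Sᶜ, greedyGain f p c b rank φ e (insert e S) +
    ∑ e, greedyGain f p c b rank φ e S + singletonValue f p eStar with hR
  have intR : HasExpectation p R :=
    ((HasExpectation.sum fun e _ => hasExpectation_greedyGain hf e _).add
      (HasExpectation.sum fun e _ => hasExpectation_greedyGain hf e _)).add
      (hasExpectation_const _)
  have intX : HasExpectation p fun φ =>
      setExpect ((runFrom g φ (Fintype.card E) fun _ => none).map dom) fun A =>
        (f (A ∪ dom (greedyFinal f p c b rank S φ)) φ : ℝ) :=
    hfin.hasExpectation 0 fun φ => abs_setExpect_le _ fun A => by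
      rw [abs_of_nonneg (NNReal.coe_nonneg _), add_zero]
      exact le_envelope f _ φ
  have intB : HasExpectation p fun φ => (f (dom (greedyFinal f p c b rank S φ)) φ : ℝ) :=
    hasExpectation_apply hfin _
  have fresh : ∀ η e, greedyNext f p c b rank S η = some e → η e = none :=
    fun η e => greedyNext_fresh
  have hcon : ∀ φ, Consistent (greedyFinal f p c b rank S φ) φ :=
    fun φ => consistent_detRun fresh (consistent_none φ)
  -- The bound `R` involves runs on other sets and is not determined by the final observation on
  -- `S`. Subtracting it on the left allows a pointwise comparison on each fibre.
  suffices h : expectOn p Set.univ (fun φ =>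
      setExpect ((runFrom g φ (Fintype.card E) fun _ => none).map dom) (fun A =>
        (f (A ∪ dom (greedyFinal f p c b rank S φ)) φ : ℝ)) - R φ) ≤
      expectOn p Set.univ fun φ => (f (dom (greedyFinal f p c b rank S φ)) φ : ℝ) by
    rw [expectOn_sub intX intR] at h
    rw [expectOn_add intB intR]
    linarith
  refine expectOn_le_of_fiberwise (greedyFinal f p c b rank S) (intX.sub intR) intB fun ψ => ?_
  rw [Set.univ_inter]
  by_cases hex : ∃ φ₀, greedyFinal f p c b rank S φ₀ = ψ
  · obtain ⟨φ₀, hφ₀⟩ := hex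
    -- Ending with `ψ` is the event of consistency with `ψ`; the trivial second condition is the
    -- empty initial observation of the other policy, which is run afresh.
    have hset : greedyFinal f p c b rank S ⁻¹' {ψ} =
        {φ | Consistent ψ φ ∧ Consistent (fun _ => none) φ} := by
      ext φ
      refine ⟨fun h => ⟨?_, consistent_none φ⟩, fun h => ?_⟩
      · rw [Set.mem_preimage, Set.mem_singleton_iff] at h
        exact h ▸ hcon φ
      · have h1 := h.1
        rw [← hφ₀] at h1
        rw [Set.mem_preimage, Set.mem_singleton_iff, ← hφ₀]
        exact detRun_eq_of_consistent fresh h1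
    have hrun := expectOn_runFrom_le hfin hf g hg ψ (residual f p ψ) (residual_nonneg ψ)
      (fun e he => by rw [residual, if_neg he]; exact le_max_right _ _) (Fintype.card E)
      fun _ => none
    simp only [dom_none, Finset.union_empty, Finset.sum_empty, sub_zero] at hrun
    rw [← hset] at hrun
    refine le_trans (expectOn_mono (intX.sub intR) ?_ fun φ hφ hp => ?_)
      (hrun.trans_eq (expectOn_congr fun φ hφ _ => ?_))
    · refine hfin.hasExpectation (∑ e, residual f p ψ e) fun φ => abs_setExpect_le _ fun A => ?_
      have h1 := le_envelope f (dom ψ ∪ A) φ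
      have h2 : ∑ e ∈ A, residual f p ψ e ≤ ∑ e, residual f p ψ e :=
        Finset.sum_le_sum_of_subset_of_nonneg (Finset.subset_univ A)
          fun e _ _ => residual_nonneg ψ e
      have h3 : 0 ≤ ∑ e ∈ A, residual f p ψ e := Finset.sum_nonneg fun e _ => residual_nonneg ψ e
      have h4 : (0 : ℝ) ≤ f (dom ψ ∪ A) φ := NNReal.coe_nonneg _
      rw [abs_le]
      constructor <;> linarith
    · rw [Set.mem_preimage, Set.mem_singleton_iff] at hφ
      rw [← setExpect_sub_const]
      refine setExpect_mono _ fun A hA => ?_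
      have h := sum_residual_le (rank := rank) hfin hf hc heStar hp S (hfeas φ hp A hA)
      rw [hφ] at h
      rw [hφ, Finset.union_comm]
      linarith
    · rw [Set.mem_preimage, Set.mem_singleton_iff] at hφ
      rw [hφ]
  · exact (expectOn_congr fun φ hφ _ => absurd ⟨φ, hφ⟩ hex).le

end Greedy

/-! ### The sampled set -/

theorem sampleLaw_toReal {σ : ℝ} (h0 : 0 < σ) (h1 : σ ≤ 1) (S : Finset E) :
    (sampleLaw E σ h0 h1 S).toReal = σ ^ S.card * (1 - σ) ^ (Fintype.card E - S.card) := by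
  have : (0 : ℝ) ≤ 1 - σ := by linarith
  simp [sampleLaw, PMF.ofFintype_apply, ENNReal.toReal_mul, ENNReal.toReal_pow,
    ENNReal.toReal_ofReal h0.le, ENNReal.toReal_ofReal this]

/-- Flipping the coin of `e` exchanges one factor `σ` for `1 - σ`. The ratio is taken in the
direction that divides only by `σ`, so `σ = 1` is included. -/
theorem sampleLaw_insert {σ : ℝ} (h0 : 0 < σ) (h1 : σ ≤ 1) {S : Finset E} {e : E} (he : e ∉ S) :
    (sampleLaw E σ h0 h1 S).toReal =
      (1 / σ - 1) * (sampleLaw E σ h0 h1 (insert e S)).toReal := by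
  have hcard : S.card < Fintype.card E :=
    Finset.card_lt_univ_of_notMem he
  rw [sampleLaw_toReal, sampleLaw_toReal, Finset.card_insert_of_notMem he]
  obtain ⟨k, hk⟩ : ∃ k, Fintype.card E - S.card = k + 1 :=
    ⟨Fintype.card E - S.card - 1, by omega⟩
  have hk' : Fintype.card E - (S.card + 1) = k := by omega
  rw [hk, hk']
  field_simp
  ring

/-- The gains missed since an item was not sampled, in comparison with the gains of sampled
items. -/
theorem sum_sampleLaw_insert {σ : ℝ} (h0 : 0 < σ) (h1 : σ ≤ 1) (G : E → Finset E → ℝ)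
    (hG : ∀ e S, e ∉ S → G e S = 0) :
    ∑ S, (sampleLaw E σ h0 h1 S).toReal * ∑ e ∈ Sᶜ, G e (insert e S) =
      (1 / σ - 1) * ∑ S, (sampleLaw E σ h0 h1 S).toReal * ∑ e, G e S := by
  have hL : ∀ S : Finset E, ∑ e ∈ Sᶜ, G e (insert e S) =
      ∑ e, if e ∉ S then G e (insert e S) else 0 := by
    intro S
    rw [← Finset.sum_filter]
    congr 1
    ext e
    simp
  simp only [hL, Finset.mul_sum]
  rw [Finset.sum_comm, Finset.sum_comm (s := Finset.univ (α := Finset E))]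
  refine Finset.sum_congr rfl fun e _ => ?_
  simp only [mul_ite, mul_zero]
  rw [← Finset.sum_filter, ← Finset.sum_filter_of_ne
    (s := Finset.univ) (p := fun S : Finset E => e ∈ S)]
  -- Sets without `e` are matched with sets containing `e`; the latter are the only ones that
  -- contribute on the right, by `hG`.
  · refine Finset.sum_nbij' (insert e) (fun S => S.erase e) ?_ ?_ ?_ ?_ ?_
    · intro S _
      simp
    · intro S _
      simp
    · intro S hS
      exact Finset.erase_insert (by simpa using hS)
    · intro S hS
      exact Finset.insert_erase (by simpa using hS)
    · intro S hS
      rw [sampleLaw_insert h0 h1 (e := e) (by simpa using hS), mul_assoc]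
  · intro S _ hS
    by_contra he
    exact hS (by rw [hG e S he]; simp)

/-! ### The sampled greedy policy -/

section SampledGreedy

variable {f : Finset E → (E → O) → ℝ≥0} {p : PMF (E → O)} {c : E → ℝ} {b : ℝ}
  {rank : PartialRealization E O → E ↪ ℕ} {σ : ℝ} {h0 : 0 < σ} {h1 : σ ≤ 1}

theorem setExpect_sampledGreedy_out (φ : E → O) (H : Finset E → ℝ) :
    setExpect ((sampledGreedy f p c b rank σ h0 h1).out φ) H =
      ∑ S, (sampleLaw E σ h0 h1 S).toReal * H (dom (greedyFinal f p c b rank S φ)) := by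
  have hout : (sampledGreedy f p c b rank σ h0 h1).out φ = (sampleLaw E σ h0 h1).bind fun S =>
      PMF.pure (dom (greedyFinal f p c b rank S φ)) := by
    change (sampleLaw E σ h0 h1).bind (fun S =>
      (runFrom (fun η => PMF.pure (greedyNext f p c b rank S η)) φ (Fintype.card E)
        fun _ => none).map dom) = _
    simp only [runFrom_pure, PMF.pure_map]
    rfl
  rw [hout, setExpect_bind, tsum_fintype]
  simp only [setExpect_pure]

theorem favg_sampledGreedy (hfin : FiniteExpectation f p) :
    favg f p (sampledGreedy f p c b rank σ h0 h1) =
      ∑ S, (sampleLaw E σ h0 h1 S).toReal * expectOn p Set.univ fun φ =>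
        (f (dom (greedyFinal f p c b rank S φ)) φ : ℝ) := by
  have h : favg f p (sampledGreedy f p c b rank σ h0 h1) =
      expectOn p Set.univ fun φ => setExpect ((sampledGreedy f p c b rank σ h0 h1).out φ)
        fun A => (f A φ : ℝ) := by
    rw [expectOn_univ]
    rfl
  rw [h]
  simp only [setExpect_sampledGreedy_out]
  rw [expectOn_sum fun S _ => (hasExpectation_apply hfin _).const_mul _]
  simp only [expectOn_const_mul]

/-- Bounds for every seed give a bound for the randomized policy. -/
theorem expectOn_policy_le (hfin : FiniteExpectation f p) (π : Policy E O)
    (B : (E → O) → Finset E) {a : ℝ}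
    (h : ∀ s ∈ π.law.support, expectOn p Set.univ (fun φ =>
      setExpect ((runFrom (π.next s) φ (Fintype.card E) fun _ => none).map dom) fun A =>
        (f (A ∪ B φ) φ : ℝ)) ≤ a) :
    expectOn p Set.univ (fun φ => setExpect (π.out φ) fun A => (f (A ∪ B φ) φ : ℝ)) ≤ a := by
  set X : π.Seed → (E → O) → ℝ := fun s φ =>
    setExpect ((runFrom (π.next s) φ (Fintype.card E) fun _ => none).map dom) fun A =>
      (f (A ∪ B φ) φ : ℝ) with hX
  have hXle : ∀ s φ, |X s φ| ≤ envelope f φ := fun s φ => abs_setExpect_le _ fun A => by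
    rw [abs_of_nonneg (NNReal.coe_nonneg _)]
    exact le_envelope f _ φ
  -- Exchanging the sums over realizations and seeds needs joint summability; the dominating series
  -- is the product of the envelope's expectation and the seed law.
  have hsum : Summable fun q : (E → O) × π.Seed =>
      (p q.1).toReal * ((π.law q.2).toReal * X q.2 q.1) := by
    refine Summable.of_norm_bounded (Summable.mul_of_nonneg hfin.envelope
      (hasSum_toReal_pmf π.law).summable
      (fun φ => mul_nonneg ENNReal.toReal_nonneg (envelope_nonneg f φ))
      fun s => ENNReal.toReal_nonneg) fun q => ?_
    rw [Real.norm_eq_abs, abs_mul, abs_mul, abs_of_nonneg ENNReal.toReal_nonneg,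
      abs_of_nonneg ENNReal.toReal_nonneg, mul_assoc, mul_comm (envelope f q.1)]
    exact mul_le_mul_of_nonneg_left (mul_le_mul_of_nonneg_left (hXle _ _) ENNReal.toReal_nonneg)
      ENNReal.toReal_nonneg
  have hcomm : expectOn p Set.univ (fun φ => setExpect (π.out φ) fun A => (f (A ∪ B φ) φ : ℝ)) =
      ∑' s, (π.law s).toReal * expectOn p Set.univ (X s) := by
    rw [expectOn_univ]
    simp only [Policy.out, setExpect_bind, expectOn_univ, ← tsum_mul_left]
    refine (Summable.tsum_comm (f := fun φ s =>
      (p φ).toReal * ((π.law s).toReal * X s φ)) hsum).symm.trans ?_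
    exact tsum_congr fun s => tsum_congr fun φ => mul_left_comm _ _ _
  have hXa : ∀ s, (π.law s).toReal * expectOn p Set.univ (X s) ≤ (π.law s).toReal * a := by
    intro s
    by_cases hs : π.law s = 0
    · simp [hs]
    · exact mul_le_mul_of_nonneg_left (h s ((PMF.mem_support_iff _ _).mpr hs))
        ENNReal.toReal_nonneg
  have hXnn : ∀ s, 0 ≤ (π.law s).toReal * expectOn p Set.univ (X s) := fun s =>
    mul_nonneg ENNReal.toReal_nonneg (expectOn_nonneg fun φ _ =>
      Finset.sum_nonneg fun A _ => mul_nonneg ENNReal.toReal_nonneg (NNReal.coe_nonneg _))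
  have ha : HasSum (fun s => (π.law s).toReal * a) a := by
    simpa using (hasSum_toReal_pmf π.law).mul_right a
  rw [hcomm]
  exact hasSum_le hXa (Summable.of_nonneg_of_le hXnn hXa ha.summable).hasSum ha

/-- `S` is independent of the realization and of the randomness of `π`, so it can be fixed outside
the expectation; the greedy run is then a function of `φ`. -/
theorem favgConcat_sampledGreedy (hfin : FiniteExpectation f p) (π : Policy E O) :
    favgConcat f p π (sampledGreedy f p c b rank σ h0 h1) =
      ∑ S, (sampleLaw E σ h0 h1 S).toReal * expectOn p Set.univ fun φ =>
        setExpect (π.out φ) fun A => (f (A ∪ dom (greedyFinal f p c b rank S φ)) φ : ℝ) := by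
  have h : favgConcat f p π (sampledGreedy f p c b rank σ h0 h1) =
      expectOn p Set.univ fun φ =>
        setExpect (concatOut π (sampledGreedy f p c b rank σ h0 h1) φ)
          fun A => (f A φ : ℝ) := by
    rw [expectOn_univ]
    rfl
  have h2 : ∀ φ, setExpect (concatOut π (sampledGreedy f p c b rank σ h0 h1) φ)
      (fun A => (f A φ : ℝ)) = ∑ S, (sampleLaw E σ h0 h1 S).toReal *
        setExpect (π.out φ) fun A => (f (A ∪ dom (greedyFinal f p c b rank S φ)) φ : ℝ) := by
    intro φ
    rw [concatOut, setExpect_bind, tsum_fintype]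
    simp only [setExpect_map, setExpect_sampledGreedy_out]
    simp only [setExpect, Finset.mul_sum]
    rw [Finset.sum_comm]
    exact Finset.sum_congr rfl fun S _ => Finset.sum_congr rfl fun A _ => mul_left_comm _ _ _
  rw [h]
  simp only [h2]
  rw [expectOn_sum]
  · simp only [expectOn_const_mul]
  · exact fun S _ => (hfin.hasExpectation 0 fun φ => abs_setExpect_le _ fun A => by
      rw [abs_of_nonneg (NNReal.coe_nonneg _), add_zero]
      exact le_envelope f _ φ).const_mul _

/-- This passes feasibility of a randomized policy on to each seed of positive probability. -/
theorem mem_support_out {π : Policy E O} {s : π.Seed} (hs : s ∈ π.law.support) {φ : E → O}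
    {A : Finset E}
    (hA : A ∈ ((runFrom (π.next s) φ (Fintype.card E) fun _ => none).map dom).support) :
    A ∈ (π.out φ).support :=
  (PMF.mem_support_bind_iff _ _ _).mpr ⟨s, hs, hA⟩

end SampledGreedy

end

end AdaptiveSubmodular

/-! ### Averaging over the sampled set -/

open AdaptiveSubmodular in
theorem mainTheorem4 {E : Type u} {O : Type v} [Fintype E] [DecidableEq E]
    (p : PMF (E → O)) (f : Finset E → (E → O) → ℝ≥0) (hfin : FiniteExpectation f p)
    (hf : IsAdaptiveSubmodular f p)
    (c : E → ℝ) (hc : ∀ e, 0 < c e) (b : ℝ)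
    (σ : ℝ) (hσ0 : 0 < σ) (hσ1 : σ ≤ 1)
    (rank : PartialRealization E O → E ↪ ℕ)
    (eStar : E) (heStar : ∀ e, singletonValue f p e ≤ singletonValue f p eStar)
    (πopt : Policy E O) (hopt : IsOptimal f p c b πopt) :
    favgConcat f p πopt (sampledGreedy f p c b rank σ hσ0 hσ1) ≤
      (2 + 1 / σ) * favg f p (sampledGreedy f p c b rank σ hσ0 hσ1) +
        singletonValue f p eStar := by
  rw [favgConcat_sampledGreedy hfin, favg_sampledGreedy hfin]
  set P : Finset E → ℝ := fun S => (sampleLaw E σ hσ0 hσ1 S).toReal with hP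
  set v : Finset E → ℝ := fun S => expectOn p Set.univ fun φ =>
    (f (dom (greedyFinal f p c b rank S φ)) φ : ℝ)
  set G : E → Finset E → ℝ := fun e S =>
    expectOn p Set.univ fun φ => greedyGain f p c b rank φ e S with hG
  have hPnn : ∀ S, 0 ≤ P S := fun S => ENNReal.toReal_nonneg
  have hPsum : ∑ S, P S = 1 := by
    have h := (hasSum_toReal_pmf (sampleLaw E σ hσ0 hσ1)).tsum_eq
    rwa [tsum_fintype] at h
  have hvnn : ∀ S, 0 ≤ v S := fun S => expectOn_nonneg fun _ _ => NNReal.coe_nonneg _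
  have hGv : ∀ S, ∑ e, G e S ≤ v S := by
    intro S
    have h := expectOn_totalGain_le (c := c) (b := b) (rank := rank) (S := S) hfin hf
      (Fintype.card E) fun _ => none
    have hset : {φ : E → O | Consistent (fun _ => none) φ} = Set.univ :=
      Set.eq_univ_of_forall consistent_none
    rw [hset] at h
    rw [hG, ← expectOn_sum fun e _ => hasExpectation_greedyGain hf e S]
    -- The collected gains amount to at most the utility minus that of the empty set, which is
    -- nonnegative.
    refine h.trans (expectOn_mono
      ((hasExpectation_apply hfin _).sub (hasExpectation_apply hfin _))
      (hasExpectation_apply hfin _) fun φ _ _ => ?_)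
    exact sub_le_self _ (NNReal.coe_nonneg _)
  have hS : ∀ S, (expectOn p Set.univ fun φ => setExpect (πopt.out φ) fun A =>
      (f (A ∪ dom (greedyFinal f p c b rank S φ)) φ : ℝ)) ≤
      v S + (∑ e ∈ Sᶜ, G e (insert e S) + ∑ e, G e S + singletonValue f p eStar) := by
    intro S
    refine expectOn_policy_le hfin πopt _ fun s hs => ?_
    refine (expectOn_union_le (rank := rank) hfin hf hc heStar (πopt.next s) (πopt.fresh s)
      (fun φ hφ A hA => hopt.1 φ hφ A (mem_support_out hs hA)) S).trans_eq ?_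
    have i1 := HasExpectation.sum (s := Sᶜ) fun e _ =>
      hasExpectation_greedyGain (c := c) (b := b) (rank := rank) hf e (insert e S)
    have i2 := HasExpectation.sum (s := Finset.univ) fun e _ =>
      hasExpectation_greedyGain (c := c) (b := b) (rank := rank) hf e S
    rw [expectOn_add (hasExpectation_apply hfin _) ((i1.add i2).add (hasExpectation_const _)),
      expectOn_add (i1.add i2) (hasExpectation_const _), expectOn_add i1 i2,
      expectOn_univ_const, expectOn_sum fun e _ => hasExpectation_greedyGain hf e _,
      expectOn_sum fun e _ => hasExpectation_greedyGain hf e _]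
  have hmiss : ∑ S, P S * ∑ e ∈ Sᶜ, G e (insert e S) =
      (1 / σ - 1) * ∑ S, P S * ∑ e, G e S :=
    sum_sampleLaw_insert hσ0 hσ1 G fun e S he => by
      simp only [hG, greedyGain_eq_zero _ he]
      exact expectOn_univ_const 0
  have hgain : ∑ S, P S * ∑ e, G e S ≤ ∑ S, P S * v S :=
    Finset.sum_le_sum fun S _ => mul_le_mul_of_nonneg_left (hGv S) (hPnn S)
  have hV : 0 ≤ ∑ S, P S * v S := Finset.sum_nonneg fun S _ => mul_nonneg (hPnn S) (hvnn S)
  calc _ ≤ ∑ S, P S * (v S +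
        (∑ e ∈ Sᶜ, G e (insert e S) + ∑ e, G e S + singletonValue f p eStar)) :=
        Finset.sum_le_sum fun S _ => mul_le_mul_of_nonneg_left (hS S) (hPnn S)
    -- Missed gains contribute `1/σ - 1` and collected gains `1`, together `1/σ`.
    _ = ∑ S, P S * v S + 1 / σ * ∑ S, P S * ∑ e, G e S + singletonValue f p eStar := by
        simp only [mul_add, Finset.sum_add_distrib]
        rw [hmiss, ← Finset.sum_mul, hPsum]
        ring
    _ ≤ _ := by
        -- This gives the coefficient `1 + 1/σ`; the remaining copy of `f_avg` in the claim is
        -- nonnegative by `hV`.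
        have := mul_le_mul_of_nonneg_left hgain (one_div_pos.mpr hσ0).le
        linarith
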